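/- Let $d$ be a natural number. All graphs are simple, countable (finite or infinite), not necessarily connected, and have all vertex degrees at most $d$. For a graph $G$, a vertex $x$ and an integer $r>0$, the rooted ball $B_r(G,x)$ is the subgraph induced on the vertices at distance at most $r$ from $x$, rooted at $x$; $\mathcal B_r(G)$ denotes the set of all rooted-isomorphism types of the balls $B_r(G,x)$, $x\in V(G)$. A sequence $(G_n)_{n\ge 1}$ converges to $G$ in the naive sense, $G_n\stackrel{n}{\to}G$, if for every $r>0$ and every rooted ball $B$, either $B\in\mathcal B_r(G_n)$ for all sufficiently large $n$ or $B\notin\mathcal B_r(G_n)$ for all sufficiently large $n$, and $B\in\mathcal B_r(G)$ if and only if $B\in \mathcal B_r(G_n)$ for all but finitely many $n$. For $H\subset V(G)$ let $\partial(H)$ be the set of vertices of $H$ having a neighbour outside $H$. An $(\varepsilon,K)$-partition of $G$ is a partition of $V(G)$ into finite nonempty classes $H_1,H_2,\dots$ such that, for each $j$, $d_G(x,y)\le K$ for all $x,y\in H_j$, and $|\partial(H_j)|/|H_j|\le\varepsilon$. A family $\mathcal G$ of graphs is strongly almost finite if for every $\varepsilon>0$ there are integers $T_\varepsilon>0$ and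 $K_\varepsilon>0$ such that every $G\in\mathcal G$ has $T_\varepsilon$ (not necessarily distinct) $(\varepsilon,K_\varepsilon)$-partitions $\{H^i_1,H^i_2,\dots\}$, $1\le i\le T_\varepsilon$, with $$\frac{|\{i : x\in\partial(H^i_j)\text{ for some } j\}|}{T_\varepsilon}<\varepsilon\qquad\text{for every } x\in V(G).$$ The Laplacian of $G$ is the bounded operator $\mathcal L_G$ on $\ell^2(V(G))$ given by $\mathcal L_G f(x)=\deg(x)f(x)-\sum_{y\sim x}f(y)$, and $\operatorname{Spec}(G)$ is its spectrum. **Theorem.** If $\{G_n\}_{n\ge1}$ is a strongly almost finite family and $G_n\stackrel{n}{\to}G$, then $\operatorname{Spec}(G_n)\to\operatorname{Spec}(G)$ in the Hausdorff metric. -/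

import Mathlib

namespace GraphLimit

/-! ### Bounded degree graphs, rooted balls and naive convergence -/

/-- Every vertex of the simple graph `G` has degree at most `d`. -/
def DegreeBound {V : Type*} (G : SimpleGraph V) (d : ℕ) : Prop :=
  ∀ x : V, (G.neighborSet x).encard ≤ d

/-- The vertex set of the closed ball of radius `r` around `x` in the graph metric; the extended
distance `edist` is infinite between distinct components. -/
def ballSet {V : Type*} (G : SimpleGraph V) (x : V) (r : ℕ) : Set V :=
  {y | G.edist x y ≤ r}

/-- A finite graph with a distinguished vertex, on a standard vertex set. Every ball in a graph of
bounded degree is finite, hence isomorphic to one of these. -/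
structure FiniteRootedGraph where
  card : ℕ
  graph : SimpleGraph (Fin card)
  root : Fin card

/-- The rooted balls of radius `r` contained in `G`: the finite rooted graphs that are
rooted-isomorphic to the subgraph induced on the ball of radius `r` around some vertex of `G`. -/
def rootedBalls {V : Type*} (G : SimpleGraph V) (r : ℕ) : Set FiniteRootedGraph :=
  {B | ∃ (x : V) (φ : B.graph ≃g G.induce (ballSet G x r)), (φ B.root : V) = x}

/-- Convergence of a sequence of graphs in the naive sense. -/
def NaivelyConvergent {V : ℕ → Type*} (G : ∀ n, SimpleGraph (V n)) : Prop :=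
  ∀ r : ℕ, 0 < r → ∀ B : FiniteRootedGraph,
    (∃ N, ∀ n ≥ N, B ∈ rootedBalls (G n) r) ∨ (∃ N, ∀ n ≥ N, B ∉ rootedBalls (G n) r)

/-- The graph `H` is a naive limit of the sequence `G`: the sequence converges in the naive sense,
and a rooted ball occurs in `H` if and only if it occurs in all but finitely many `G n`. -/
def NaiveLimit {V : ℕ → Type*} (G : ∀ n, SimpleGraph (V n))
    {W : Type*} (H : SimpleGraph W) : Prop :=
  NaivelyConvergent G ∧
    ∀ r : ℕ, 0 < r → ∀ B : FiniteRootedGraph,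
      B ∈ rootedBalls H r ↔ ∃ N, ∀ n ≥ N, B ∈ rootedBalls (G n) r

/-! ### Strong almost finiteness -/

/-- The vertices of `H` that have a neighbour outside `H`. -/
def vertexBoundary {V : Type*} (G : SimpleGraph V) (H : Set V) : Set V :=
  {x | x ∈ H ∧ ∃ y, y ∉ H ∧ G.Adj x y}

/-- `P` is an `(ε, K)`-partition of the vertex set of `G`: its classes are finite and nonempty,
any two vertices of a class are at distance at most `K` in `G`, and each class has isoperimetric
constant at most `ε`. -/
def IsEpsPartition {V : Type*} (G : SimpleGraph V) (ε : ℝ) (K : ℕ) (P : Set (Set V)) : Prop :=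
  Setoid.IsPartition P ∧
    ∀ H ∈ P, H.Finite ∧ (∀ x ∈ H, ∀ y ∈ H, G.edist x y ≤ K) ∧
      ((vertexBoundary G H).ncard : ℝ) / (H.ncard : ℝ) ≤ ε

/-- A family of graphs is strongly almost finite. The numbers `T` and `K` depend on `ε` only. -/
def StronglyAlmostFinite {ι : Type*} {V : ι → Type*} (G : ∀ i, SimpleGraph (V i)) : Prop :=
  ∀ ε : ℝ, 0 < ε → ∃ T K : ℕ, 0 < T ∧ 0 < K ∧
    ∀ i, ∃ P : Fin T → Set (Set (V i)),
      (∀ t, IsEpsPartition (G i) ε K (P t)) ∧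
      ∀ x : V i,
        (({t : Fin T | ∃ H ∈ P t, x ∈ vertexBoundary (G i) H}.ncard : ℝ) / (T : ℝ)) < ε

/-! ### The Laplacian on square-summable functions -/

/-- `(L f)(x) = deg(x) f(x) - ∑_{y ∼ x} f(y)`, as a function on vertices. -/
noncomputable def laplacianFun {V : Type*} (G : SimpleGraph V) (f : V → ℂ) (x : V) : ℂ :=
  ((G.neighborSet x).ncard : ℂ) * f x - ∑ᶠ y ∈ G.neighborSet x, f y

theorem DegreeBound.finite {V : Type*} {G : SimpleGraph V} {d : ℕ} (h : DegreeBound G d) (x : V) :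
    (G.neighborSet x).Finite :=
  Set.finite_of_encard_le_coe (h x)

theorem DegreeBound.card_le {V : Type*} {G : SimpleGraph V} {d : ℕ} (h : DegreeBound G d) (x : V) :
    (h.finite x).toFinset.card ≤ d := by
  have := h x
  rw [(h.finite x).encard_eq_coe_toFinset_card] at this
  exact_mod_cast this

theorem laplacianFun_eq_sum {V : Type*} {G : SimpleGraph V} {d : ℕ} (h : DegreeBound G d)
    (f : V → ℂ) (x : V) :
    laplacianFun G f x = ∑ y ∈ (h.finite x).toFinset, (f x - f y) := by
  rw [laplacianFun, finsum_mem_eq_finite_toFinset_sum _ (h.finite x),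
    Set.ncard_eq_toFinset_card _ (h.finite x), Finset.sum_sub_distrib, Finset.sum_const,
    nsmul_eq_mul]

theorem norm_laplacianFun_sq_le {V : Type*} {G : SimpleGraph V} {d : ℕ} (h : DegreeBound G d)
    (f : V → ℂ) (x : V) :
    ‖laplacianFun G f x‖ ^ 2 ≤
      2 * d ^ 2 * ‖f x‖ ^ 2 + 2 * d * ∑ y ∈ (h.finite x).toFinset, ‖f y‖ ^ 2 := by
  have hc : ((h.finite x).toFinset.card : ℝ) ≤ d := by exact_mod_cast h.card_le x
  rw [laplacianFun_eq_sum h]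
  calc ‖∑ y ∈ (h.finite x).toFinset, (f x - f y)‖ ^ 2
      ≤ (∑ y ∈ (h.finite x).toFinset, ‖f x - f y‖) ^ 2 := by gcongr; exact norm_sum_le _ _
    _ ≤ (h.finite x).toFinset.card * ∑ y ∈ (h.finite x).toFinset, ‖f x - f y‖ ^ 2 :=
        sq_sum_le_card_mul_sum_sq
    _ ≤ d * ∑ y ∈ (h.finite x).toFinset, (2 * ‖f x‖ ^ 2 + 2 * ‖f y‖ ^ 2) := by
        gcongr with y _
        nlinarith [norm_sub_le (f x) (f y), norm_nonneg (f x - f y), norm_nonneg (f x),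
          norm_nonneg (f y), sq_nonneg (‖f x‖ - ‖f y‖)]
    _ = d * ((h.finite x).toFinset.card * (2 * ‖f x‖ ^ 2)
          + 2 * ∑ y ∈ (h.finite x).toFinset, ‖f y‖ ^ 2) := by
        rw [Finset.sum_add_distrib, Finset.sum_const, nsmul_eq_mul, Finset.mul_sum]
    _ ≤ d * (d * (2 * ‖f x‖ ^ 2) + 2 * ∑ y ∈ (h.finite x).toFinset, ‖f y‖ ^ 2) := by gcongr
    _ = _ := by ring

theorem sum_neighbors_le {V : Type*} {G : SimpleGraph V} {d : ℕ} (h : DegreeBound G d)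
    {g : V → ℝ} (hg : ∀ y, 0 ≤ g y) {C : ℝ} (hC : ∀ s : Finset V, ∑ y ∈ s, g y ≤ C)
    (s : Finset V) :
    ∑ x ∈ s, ∑ y ∈ (h.finite x).toFinset, g y ≤ d * C := by
  classical
  have hswap : ∑ x ∈ s, ∑ y ∈ (h.finite x).toFinset, g y =
      ∑ y ∈ s.biUnion fun x => (h.finite x).toFinset,
        ∑ _x ∈ s ∩ (h.finite y).toFinset, g y := by
    apply Finset.sum_comm'
    intro x y
    simp only [Set.Finite.mem_toFinset, SimpleGraph.mem_neighborSet, Finset.mem_inter,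
      Finset.mem_biUnion]
    constructor
    · rintro ⟨hx, hxy⟩
      exact ⟨⟨hx, hxy.symm⟩, x, hx, hxy⟩
    · rintro ⟨⟨hx, hyx⟩, -⟩
      exact ⟨hx, hyx.symm⟩
  rw [hswap]
  calc _ ≤ ∑ y ∈ s.biUnion fun x => (h.finite x).toFinset, (d : ℝ) * g y := by
        refine Finset.sum_le_sum fun y _ => ?_
        rw [Finset.sum_const, nsmul_eq_mul]
        refine mul_le_mul_of_nonneg_right ?_ (hg y)
        exact_mod_cast (Finset.card_le_card Finset.inter_subset_right).trans (h.card_le y)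
    _ ≤ d * C := by
        rw [← Finset.mul_sum]
        exact mul_le_mul_of_nonneg_left (hC _) (Nat.cast_nonneg d)

theorem sum_norm_sq_le {V : Type*} (f : lp (fun _ : V => ℂ) 2) (s : Finset V) :
    ∑ x ∈ s, ‖f x‖ ^ 2 ≤ ‖f‖ ^ 2 := by
  have := lp.sum_rpow_le_norm_rpow (p := 2) (by simp) f s
  simpa using this

theorem sum_norm_laplacianFun_sq_le {V : Type*} {G : SimpleGraph V} {d : ℕ} (h : DegreeBound G d)
    (f : lp (fun _ : V => ℂ) 2) (s : Finset V) :
    ∑ x ∈ s, ‖laplacianFun G f x‖ ^ 2 ≤ (2 * d * ‖f‖) ^ 2 := by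
  calc ∑ x ∈ s, ‖laplacianFun G f x‖ ^ 2
      ≤ ∑ x ∈ s, (2 * d ^ 2 * ‖f x‖ ^ 2
          + 2 * d * ∑ y ∈ (h.finite x).toFinset, ‖f y‖ ^ 2) :=
        Finset.sum_le_sum fun x _ => norm_laplacianFun_sq_le h f x
    _ = 2 * d ^ 2 * ∑ x ∈ s, ‖f x‖ ^ 2
          + 2 * d * ∑ x ∈ s, ∑ y ∈ (h.finite x).toFinset, ‖f y‖ ^ 2 := by
        rw [Finset.sum_add_distrib, Finset.mul_sum, Finset.mul_sum]
    _ ≤ 2 * d ^ 2 * ‖f‖ ^ 2 + 2 * d * (d * ‖f‖ ^ 2) := by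
        gcongr
        · exact sum_norm_sq_le f s
        · exact sum_neighbors_le h (fun y => sq_nonneg _) (sum_norm_sq_le f) s
    _ = (2 * d * ‖f‖) ^ 2 := by ring

theorem memlp_laplacianFun {V : Type*} {G : SimpleGraph V} {d : ℕ} (h : DegreeBound G d)
    (f : lp (fun _ : V => ℂ) 2) : Memℓp (laplacianFun G f) 2 := by
  refine memℓp_gen' (C := (2 * d * ‖f‖) ^ 2) fun s => ?_
  simpa using sum_norm_laplacianFun_sq_le h f s

theorem laplacianFun_add {V : Type*} {G : SimpleGraph V} {d : ℕ} (h : DegreeBound G d)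
    (f g : V → ℂ) : laplacianFun G (f + g) = laplacianFun G f + laplacianFun G g := by
  ext x
  simp only [Pi.add_apply, laplacianFun_eq_sum h, ← Finset.sum_add_distrib]
  exact Finset.sum_congr rfl fun y _ => by ring

theorem laplacianFun_smul {V : Type*} {G : SimpleGraph V} {d : ℕ} (h : DegreeBound G d)
    (c : ℂ) (f : V → ℂ) : laplacianFun G (c • f) = c • laplacianFun G f := by
  ext x
  simp only [Pi.smul_apply, smul_eq_mul, laplacianFun_eq_sum h, Finset.mul_sum]
  exact Finset.sum_congr rfl fun y _ => by ring

/-- The Laplacian of a graph of bounded degree, as a bounded operator on the complex Hilbert space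
of square-summable functions on the vertices. -/
noncomputable def laplacian {V : Type*} (G : SimpleGraph V) (d : ℕ) (h : DegreeBound G d) :
    lp (fun _ : V => ℂ) 2 →L[ℂ] lp (fun _ : V => ℂ) 2 :=
  LinearMap.mkContinuous
    { toFun := fun f => ⟨laplacianFun G f, memlp_laplacianFun h f⟩
      map_add' := fun f g => by
        ext1
        exact laplacianFun_add h f g
      map_smul' := fun c f => by
        ext1
        exact laplacianFun_smul h c f }
    (2 * d)
    (fun f => by
      refine lp.norm_le_of_forall_sum_le (p := 2) (by simp) (by positivity) fun s => ?_
      simpa using sum_norm_laplacianFun_sq_le h f s)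

theorem laplacian_apply {V : Type*} (G : SimpleGraph V) (d : ℕ) (h : DegreeBound G d)
    (f : lp (fun _ : V => ℂ) 2) (x : V) :
    laplacian G d h f x = ((G.neighborSet x).ncard : ℂ) * f x - ∑ᶠ y ∈ G.neighborSet x, f y :=
  rfl

end GraphLimit

/-! The Laplacian is self-adjoint, so a real `z` lies within `δ` of its spectrum as soon as some
nonzero `f` has `‖L f - z f‖ ≤ δ ‖f‖`, and every spectral value admits such `f` for every `δ > 0`.
If `f` is supported in a ball of radius `r`, the inequality depends only on the ball of radius `r +
1`, so it transfers to any graph containing that ball (`HasLocalEigenfunction.of_iso`).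

The core is localization with a radius uniform in `n`
(`StronglyAlmostFinite.exists_hasLocalEigenfunction`). Cut an approximate eigenfunction along the
classes of all `T` partitions. The energies of the pieces add up to `T` times that of `f`, while the
errors created by cutting are carried by boundary vertices, each of which is cut in few partitions.
On average the pieces are still approximate eigenfunctions, so one of them is, and its support has
diameter at most `K`.

Bounded degree leaves finitely many ball types of a given radius, so eventually `G n` and the limit
have the same ones; hence `Spec (G n)` is near the limit spectrum. Conversely, compactness reduces
the limit spectrum to finitely many points, each witnessed in one ball. -/

open scoped InnerProductSpace ENNReal

namespace GraphLimit

/-! ### Spectrum and approximate eigenvectors of self-adjoint operators. -/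

section Hilbert

variable {E : Type*} [NormedAddCommGroup E] [InnerProductSpace ℂ E] [CompleteSpace E]

/-- Every point of the spectrum of a self-adjoint operator is an approximate eigenvalue. -/
theorem exists_norm_sub_smul_lt_of_mem_spectrum {A : E →L[ℂ] E} (hA : IsSelfAdjoint A) {z : ℂ}
    (hz : z ∈ spectrum ℂ A) {δ : ℝ} (hδ : 0 < δ) : ∃ f : E, ‖A f - z • f‖ < δ * ‖f‖ := by
  by_contra! hcon
  have hre : (z.re : ℂ) = z := (hA.mem_spectrum_eq_re hz).symm
  have hB : IsSelfAdjoint (algebraMap ℂ (E →L[ℂ] E) z - A) := by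
    refine IsSelfAdjoint.sub ?_ hA
    rw [← hre]
    exact IsSelfAdjoint.algebraMap _ (by simp [IsSelfAdjoint])
  have hBapp : ∀ f, ‖(algebraMap ℂ (E →L[ℂ] E) z - A) f‖ = ‖A f - z • f‖ := fun f => by
    rw [← norm_neg]
    simp [Algebra.algebraMap_eq_smul_one]
  refine hz (?_ : IsUnit (algebraMap ℂ (E →L[ℂ] E) z - A))
  rw [ContinuousLinearMap.isUnit_iff_bijective,
    ContinuousLinearMap.bijective_iff_dense_range_and_antilipschitz]
  set B := algebraMap ℂ (E →L[ℂ] E) z - A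
  have hbelow : ∀ f, ‖f‖ ≤ δ⁻¹ * ‖B f‖ := fun f => by
    rw [hBapp, inv_mul_eq_div, le_div_iff₀ hδ, mul_comm]
    exact hcon f
  refine ⟨?_, ⟨δ⁻¹, by positivity⟩, B.antilipschitz_of_bound hbelow⟩
  -- Dense range: the orthogonal complement of the range of the self-adjoint `B` is its kernel,
  -- which is zero because `B` is bounded below.
  rw [Submodule.topologicalClosure_eq_top_iff, Submodule.eq_bot_iff]
  intro v hv
  have hBv : B v = 0 := by
    refine ext_inner_left ℂ fun w => ?_
    have := (Submodule.mem_orthogonal _ _).1 hv (B w) ⟨w, rfl⟩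
    rw [inner_zero_right, ← this]
    have h := ContinuousLinearMap.adjoint_inner_left B v w
    rw [hB.adjoint_eq] at h
    exact h.symm
  have := hbelow v
  rw [hBv, norm_zero, mul_zero] at this
  exact norm_le_zero_iff.1 this

/-- An approximate eigenvalue of a self-adjoint operator is close to the spectrum. -/
theorem exists_mem_spectrum_dist_le {A : E →L[ℂ] E} (hA : IsSelfAdjoint A) {z : ℂ}
    (hre : (z.re : ℂ) = z) {ε : ℝ} {f : E} (hf : f ≠ 0) (h : ‖A f - z • f‖ ≤ ε * ‖f‖) :
    ∃ w ∈ spectrum ℂ A, dist w z ≤ ε := by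
  by_contra! hcon
  have hfpos : 0 < ‖f‖ := norm_pos_iff.2 hf
  have hε : 0 ≤ ε := nonneg_of_mul_nonneg_left ((norm_nonneg _).trans h) hfpos
  have : Nontrivial E := ⟨f, 0, hf⟩
  have hz : z ∉ spectrum ℂ A := fun hz => by
    have := hcon z hz
    rw [dist_self] at this
    exact this.not_ge hε
  obtain ⟨u, hu⟩ := spectrum.notMem_iff.1 hz
  have hB : IsSelfAdjoint (u : E →L[ℂ] E) := by
    rw [hu]
    refine IsSelfAdjoint.sub ?_ hA
    rw [← hre]
    exact IsSelfAdjoint.algebraMap _ (by simp [IsSelfAdjoint])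
  have hR : IsSelfAdjoint ((u⁻¹ : (E →L[ℂ] E)ˣ) : E →L[ℂ] E) := by
    have : star u = u := Units.ext hB
    rw [IsSelfAdjoint, ← Units.coe_star, star_inv, this]
  -- The resolvent is self-adjoint, so its norm is attained as `‖ν‖` for a spectral value `ν`. Then
  -- `ν⁻¹ = z - w` with `w` in the spectrum of `A`, which bounds the resolvent norm strictly below
  -- `1 / ε`.
  obtain ⟨ν, hν, hνr⟩ := spectrum.exists_nnnorm_eq_spectralRadius
    ((u⁻¹ : (E →L[ℂ] E)ˣ) : E →L[ℂ] E)
  rw [hR.spectralRadius_eq_nnnorm] at hνr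
  have hnorm : ‖ν‖ = ‖((u⁻¹ : (E →L[ℂ] E)ˣ) : E →L[ℂ] E)‖ :=
    congrArg NNReal.toReal (ENNReal.coe_injective hνr)
  have hν0 : ν ≠ 0 := spectrum.ne_zero_of_mem_of_unit hν
  have hmem : ν⁻¹ ∈ spectrum ℂ (u : E →L[ℂ] E) := by
    have := (spectrum.inv_mem_iff (r := Units.mk0 ν hν0) (a := u⁻¹)).1 hν
    simpa using this
  rw [hu, ← spectrum.singleton_sub_eq, Set.mem_sub] at hmem
  obtain ⟨z', rfl, w, hw, hzw⟩ := hmem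
  have hdist : ε < ‖ν‖⁻¹ := by
    rw [← norm_inv, ← hzw, ← dist_eq_norm, dist_comm]
    exact hcon w hw
  have hle : ‖f‖ ≤ ‖ν‖ * ‖A f - z' • f‖ := by
    have h1 : ((u⁻¹ : (E →L[ℂ] E)ˣ) : E →L[ℂ] E) ((u : E →L[ℂ] E) f) = f := by
      rw [← mul_apply_eq_comp, Units.inv_mul, one_apply_eq_self]
    have h2 : ‖(u : E →L[ℂ] E) f‖ = ‖A f - z' • f‖ := by
      rw [hu, ← norm_neg]
      simp [Algebra.algebraMap_eq_smul_one]
    calc ‖f‖ = ‖((u⁻¹ : (E →L[ℂ] E)ˣ) : E →L[ℂ] E) ((u : E →L[ℂ] E) f)‖ := by rw [h1]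
      _ ≤ _ := by
        rw [hnorm, ← h2]
        exact ContinuousLinearMap.le_opNorm _ _
  have hνpos : 0 < ‖ν‖ := norm_pos_iff.2 hν0
  have h3 : ‖ν‖ * ε < 1 := by
    rw [← mul_inv_cancel₀ hνpos.ne']
    exact mul_lt_mul_of_pos_left hdist hνpos
  have h4 : ‖ν‖ * ‖A f - z' • f‖ ≤ (‖ν‖ * ε) * ‖f‖ := by
    rw [mul_assoc]
    exact mul_le_mul_of_nonneg_left h hνpos.le
  nlinarith

end Hilbert

/-! ### Self-adjointness of the Laplacian and the spectral criterion in terms of energies. -/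

section Laplacian

variable {V : Type*} {G : SimpleGraph V} {d : ℕ}

theorem laplacian_single [DecidableEq V] (h : DegreeBound G d) (x : V) :
    laplacian G d h (lp.single 2 x (1 : ℂ)) =
      ∑ y ∈ (h.finite x).toFinset, (lp.single 2 x (1 : ℂ) - lp.single 2 y (1 : ℂ)) := by
  ext z
  rw [lp.coeFn_sum, Finset.sum_apply]
  change laplacianFun G _ z = _
  rw [laplacianFun_eq_sum h]
  simp only [lp.coeFn_sub, Pi.sub_apply, lp.coeFn_single, Finset.sum_sub_distrib, Pi.single_apply]
  by_cases hzx : z = x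
  · subst hzx
    congr 1
    refine Finset.sum_congr rfl fun y _ => ?_
    simp [eq_comm]
  · have hx : x ∈ (h.finite z).toFinset ↔ z ∈ (h.finite x).toFinset := by
      simp [SimpleGraph.adj_comm]
    simp [hzx, hx, -Set.Finite.mem_toFinset]

theorem isSelfAdjoint_laplacian (h : DegreeBound G d) : IsSelfAdjoint (laplacian G d h) := by
  classical
  rw [ContinuousLinearMap.isSelfAdjoint_iff']
  ext f x
  -- Evaluation at `x` is pairing with the point mass, so the adjoint is read off from the Laplacian
  -- of point masses.
  have key : ∀ g : lp (fun _ : V => ℂ) 2, g x = ⟪lp.single 2 x (1 : ℂ), g⟫_ℂ := fun g => by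
    simp [lp.inner_single_left]
  rw [key, ContinuousLinearMap.adjoint_inner_right, laplacian_single, sum_inner]
  change _ = laplacianFun G f x
  rw [laplacianFun_eq_sum h]
  refine Finset.sum_congr rfl fun y _ => ?_
  simp [inner_sub_left, lp.inner_single_left]

/-- The square of the `ℓ²` norm of a function, possibly infinite. -/
noncomputable def energy {V : Type*} (f : V → ℂ) : ℝ≥0∞ := ∑' x, ‖f x‖ₑ ^ 2

/-- The function `L f - z f`. -/
noncomputable def shiftedLaplacian {V : Type*} (G : SimpleGraph V) (z : ℂ) (f : V → ℂ) (x : V) : ℂ :=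
  laplacianFun G f x - z * f x

/-- Links the Hilbert norm to sums in `ℝ≥0∞`, where the later interchanges of summation need no
summability hypotheses. -/
theorem energy_coe (f : lp (fun _ : V => ℂ) 2) : energy f = ENNReal.ofReal (‖f‖ ^ 2) := by
  have h := lp.norm_rpow_eq_tsum (p := 2) (by simp) f
  simp only [ENNReal.toReal_ofNat, Real.rpow_ofNat] at h
  have hs : Summable fun x => ‖f x‖ ^ 2 := by
    simpa using (lp.memℓp f).summable (by simp)
  rw [h, ENNReal.ofReal_tsum_of_nonneg (fun x => by positivity) hs, energy]
  refine tsum_congr fun x => ?_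
  rw [ENNReal.ofReal_pow (norm_nonneg _), ofReal_norm]

theorem memlp_of_energy_ne_top {f : V → ℂ} (hf : energy f ≠ ∞) : Memℓp f 2 := by
  rw [memℓp_gen_iff (by simp)]
  have := ENNReal.summable_toReal hf
  simpa using this

theorem energy_shiftedLaplacian_coe (h : DegreeBound G d) (z : ℂ) (f : lp (fun _ : V => ℂ) 2) :
    energy (shiftedLaplacian G z f) = ENNReal.ofReal (‖laplacian G d h f - z • f‖ ^ 2) := by
  rw [← energy_coe]
  rfl

/-- Points of the spectrum admit finitely supported approximate eigenfunctions. -/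
theorem exists_finite_support_of_mem_spectrum (h : DegreeBound G d) {z : ℂ}
    (hz : z ∈ spectrum ℂ (laplacian G d h)) {δ : ℝ} (hδ : 0 < δ) :
    ∃ f : V → ℂ, f.support.Finite ∧ energy f ≠ 0 ∧ energy f ≠ ∞ ∧
      energy (shiftedLaplacian G z f) ≤ ENNReal.ofReal (δ ^ 2) * energy f := by
  classical
  obtain ⟨f, hf⟩ := exists_norm_sub_smul_lt_of_mem_spectrum (isSelfAdjoint_laplacian h) hz hδ
  have hlim : Filter.Tendsto (fun s : Finset V => ∑ x ∈ s, lp.single 2 x (f x)) Filter.atTop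
      (nhds f) := lp.hasSum_single (by simp) f
  -- The strict inequality is an open condition, so it passes from `f` to a finite truncation;
  -- strictness also makes the truncation nonzero.
  have hopen : IsOpen {g : lp (fun _ : V => ℂ) 2 | ‖laplacian G d h g - z • g‖ < δ * ‖g‖} :=
    isOpen_lt (by fun_prop) (by fun_prop)
  obtain ⟨s, hs⟩ := (hlim.eventually (hopen.mem_nhds hf)).exists
  set g := ∑ x ∈ s, lp.single 2 x (f x) with hg
  change ‖laplacian G d h g - z • g‖ < δ * ‖g‖ at hs
  have hgpos : 0 < ‖g‖ := pos_of_mul_pos_right ((norm_nonneg _).trans_lt hs) hδ.le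
  refine ⟨g, s.finite_toSet.subset fun x hx => ?_, ?_, ?_, ?_⟩
  · by_contra hxs
    refine hx ?_
    rw [hg, lp.coeFn_sum, Finset.sum_apply]
    refine Finset.sum_eq_zero fun y hy => ?_
    rw [lp.coeFn_single, Pi.single_apply, if_neg]
    rintro rfl
    exact hxs hy
  · rw [energy_coe]
    simpa using hgpos
  · rw [energy_coe]
    exact ENNReal.ofReal_ne_top
  · rw [energy_shiftedLaplacian_coe h, energy_coe, ← ENNReal.ofReal_mul (by positivity), ← mul_pow]
    exact ENNReal.ofReal_le_ofReal (by gcongr)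

/-- A square-summable approximate eigenfunction forces a nearby point of the spectrum. -/
theorem exists_mem_spectrum_of_energy_le (h : DegreeBound G d) {z : ℂ} (hre : (z.re : ℂ) = z)
    {δ : ℝ} (hδ : 0 ≤ δ) {f : V → ℂ} (hf0 : energy f ≠ 0) (hf : energy f ≠ ∞)
    (hle : energy (shiftedLaplacian G z f) ≤ ENNReal.ofReal (δ ^ 2) * energy f) :
    ∃ w ∈ spectrum ℂ (laplacian G d h), dist w z ≤ δ := by
  obtain ⟨g, rfl⟩ : ∃ g : lp (fun _ : V => ℂ) 2, (g : V → ℂ) = f :=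
    ⟨⟨f, memlp_of_energy_ne_top hf⟩, rfl⟩
  have hg : g ≠ 0 := by
    rintro rfl
    rw [energy_coe] at hf0
    simp at hf0
  refine exists_mem_spectrum_dist_le (isSelfAdjoint_laplacian h) hre hg ?_
  rw [energy_shiftedLaplacian_coe h, energy_coe, ← ENNReal.ofReal_mul (by positivity), ← mul_pow,
    ENNReal.ofReal_le_ofReal_iff (by positivity)] at hle
  exact (pow_le_pow_iff_left₀ (norm_nonneg _) (by positivity) two_ne_zero).1 hle

end Laplacian

/-! ### Cutting approximate eigenfunctions along partitions. -/

section Localization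

variable {V : Type*} {G : SimpleGraph V} {d : ℕ}

theorem enorm_add_sq_le (a b : ℂ) : ‖a + b‖ₑ ^ 2 ≤ 2 * ‖a‖ₑ ^ 2 + 2 * ‖b‖ₑ ^ 2 := by
  simp only [enorm_eq_nnnorm]
  norm_cast
  have h : ‖a + b‖₊ ≤ ‖a‖₊ + ‖b‖₊ := nnnorm_add_le a b
  calc ‖a + b‖₊ ^ 2 ≤ (‖a‖₊ + ‖b‖₊) ^ 2 := by gcongr
    _ ≤ _ := by
      rw [← mul_add]
      exact add_sq_le

theorem enorm_sum_sq_le {ι : Type*} (s : Finset ι) (a : ι → ℂ) :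
    ‖∑ i ∈ s, a i‖ₑ ^ 2 ≤ s.card * ∑ i ∈ s, ‖a i‖ₑ ^ 2 := by
  simp only [enorm_eq_nnnorm]
  norm_cast
  calc ‖∑ i ∈ s, a i‖₊ ^ 2 ≤ (∑ i ∈ s, ‖a i‖₊) ^ 2 := by gcongr; exact nnnorm_sum_le _ _
    _ ≤ _ := sq_sum_le_card_mul_sum_sq

open Classical in
/-- The restriction of `f` to the class `a` of the colouring `c`, extended by zero. -/
noncomputable def classPart {ι : Type*} (c : V → ι) (f : V → ℂ) (a : ι) (x : V) : ℂ :=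
  if c x = a then f x else 0

theorem tsum_enorm_classPart_sq {ι : Type*} (c : V → ι) (f : V → ℂ) (x : V) :
    ∑' a, ‖classPart c f a x‖ₑ ^ 2 = ‖f x‖ₑ ^ 2 := by
  rw [tsum_eq_single (c x)]
  · simp [classPart]
  · intro a ha
    simp [classPart, ha.symm]

theorem tsum_energy_classPart {ι : Type*} (c : V → ι) (f : V → ℂ) :
    ∑' a, energy (classPart c f a) = energy f := by
  unfold energy
  rw [ENNReal.tsum_comm]
  exact tsum_congr fun x => tsum_enorm_classPart_sq c f x

open Classical in
-- Commutator of the Laplacian with a class indicator: the correction only involves edges joining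
-- different classes.
theorem shiftedLaplacian_classPart {ι : Type*} (h : DegreeBound G d) (z : ℂ) (c : V → ι)
    (f : V → ℂ) (a : ι) (x : V) :
    shiftedLaplacian G z (classPart c f a) x = classPart c (shiftedLaplacian G z f) a x +
      ∑ y ∈ (h.finite x).toFinset,
        ((if c x = a then f y else 0) - if c y = a then f y else 0) := by
  simp only [shiftedLaplacian, classPart, laplacianFun_eq_sum h]
  split_ifs
  · simp only [Finset.sum_sub_distrib]
    ring
  · simp

open Classical in
-- A cut edge is seen only by the two classes of its endpoints, whence the factor 2.
theorem tsum_enorm_ite_sub_ite_sq_le {ι : Type*} (i j : ι) (w : ℂ) :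
    ∑' a, ‖(if i = a then w else 0) - (if j = a then w else 0)‖ₑ ^ 2 ≤
      if i = j then 0 else 2 * ‖w‖ₑ ^ 2 := by
  split_ifs with hij
  · simp [hij]
  · calc _ ≤ ∑' a, ((if i = a then ‖w‖ₑ ^ 2 else 0) + if j = a then ‖w‖ₑ ^ 2 else 0) := by
          refine ENNReal.tsum_le_tsum fun a => ?_
          by_cases hi : i = a
          · have hj : j ≠ a := fun hj => hij (hi.trans hj.symm)
            simp [hi, hj]
          · by_cases hj : j = a <;> simp [hi, hj]
      _ = 2 * ‖w‖ₑ ^ 2 := by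
          rw [ENNReal.tsum_add, tsum_eq_single i (by intro b hb; simp [hb.symm]),
            tsum_eq_single j (by intro b hb; simp [hb.symm])]
          simp [two_mul]

open Classical in
theorem tsum_enorm_shiftedLaplacian_classPart_le {ι : Type*} (h : DegreeBound G d) (z : ℂ)
    (c : V → ι) (f : V → ℂ) (x : V) :
    ∑' a, ‖shiftedLaplacian G z (classPart c f a) x‖ₑ ^ 2 ≤
      2 * ‖shiftedLaplacian G z f x‖ₑ ^ 2 +
        4 * d * ∑' y, if G.Adj x y ∧ c x ≠ c y then ‖f y‖ₑ ^ 2 else 0 := by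
  have hc : ((h.finite x).toFinset.card : ℝ≥0∞) ≤ d := by exact_mod_cast h.card_le x
  calc _ ≤ ∑' a, (2 * ‖classPart c (shiftedLaplacian G z f) a x‖ₑ ^ 2 +
        2 * (d * ∑ y ∈ (h.finite x).toFinset,
          ‖(if c x = a then f y else 0) - if c y = a then f y else 0‖ₑ ^ 2)) := by
        refine ENNReal.tsum_le_tsum fun a => ?_
        rw [shiftedLaplacian_classPart h]
        refine (enorm_add_sq_le _ _).trans ?_
        gcongr
        refine (enorm_sum_sq_le _ _).trans ?_
        gcongr
    _ = 2 * ‖shiftedLaplacian G z f x‖ₑ ^ 2 + 2 * (d * ∑ y ∈ (h.finite x).toFinset,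
          ∑' a, ‖(if c x = a then f y else 0) - if c y = a then f y else 0‖ₑ ^ 2) := by
        rw [ENNReal.tsum_add, ENNReal.tsum_mul_left, tsum_enorm_classPart_sq,
          ENNReal.tsum_mul_left, ENNReal.tsum_mul_left,
          Summable.tsum_finsetSum fun _ _ => ENNReal.summable]
    _ ≤ 2 * ‖shiftedLaplacian G z f x‖ₑ ^ 2 + 2 * (d * ∑ y ∈ (h.finite x).toFinset,
          2 * if G.Adj x y ∧ c x ≠ c y then ‖f y‖ₑ ^ 2 else 0) := by
        gcongr with y hy
        refine (tsum_enorm_ite_sub_ite_sq_le _ _ _).trans ?_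
        have : G.Adj x y := by simpa using hy
        by_cases hxy : c x = c y <;> simp [this, hxy]
    _ ≤ _ := by
        rw [← Finset.mul_sum]
        refine add_le_add le_rfl ?_
        calc _ = 4 * d * ∑ y ∈ (h.finite x).toFinset,
              (if G.Adj x y ∧ c x ≠ c y then ‖f y‖ₑ ^ 2 else 0) := by ring
          _ ≤ _ := by
            gcongr
            exact ENNReal.sum_le_tsum _

open Classical in
-- Summing the pointwise bound over `x` charges each vertex `y` once per neighbour across the cut,
-- hence at most `d` times; this is the second factor `d`.
theorem tsum_energy_shiftedLaplacian_classPart_le {ι : Type*} (h : DegreeBound G d) (z : ℂ)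
    (c : V → ι) (f : V → ℂ) :
    ∑' a, energy (shiftedLaplacian G z (classPart c f a)) ≤
      2 * energy (shiftedLaplacian G z f) +
        4 * d ^ 2 * ∑' y, if ∃ x, G.Adj x y ∧ c x ≠ c y then ‖f y‖ₑ ^ 2 else 0 := by
  unfold energy
  rw [ENNReal.tsum_comm]
  refine (ENNReal.tsum_le_tsum fun x =>
    tsum_enorm_shiftedLaplacian_classPart_le h z c f x).trans ?_
  rw [ENNReal.tsum_add, ENNReal.tsum_mul_left, ENNReal.tsum_mul_left]
  refine add_le_add le_rfl ?_
  rw [ENNReal.tsum_comm, show ∀ S : ℝ≥0∞, 4 * d ^ 2 * S = 4 * d * (d * S) from fun S => by ring,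
    ← ENNReal.tsum_mul_left (a := (d : ℝ≥0∞))]
  refine mul_le_mul_right (ENNReal.tsum_le_tsum fun y => ?_) _
  split_ifs with hy
  · calc _ ≤ ∑' x, if x ∈ (h.finite y).toFinset then ‖f y‖ₑ ^ 2 else 0 := by
          refine ENNReal.tsum_le_tsum fun x => ?_
          by_cases hxy : G.Adj x y
          · rw [if_pos (show x ∈ (h.finite y).toFinset by simpa using hxy.symm)]
            split_ifs <;> simp
          · simp [hxy]
      _ = (h.finite y).toFinset.card * ‖f y‖ₑ ^ 2 := by
          rw [tsum_eq_sum (s := (h.finite y).toFinset) (by intro b hb; simp only [hb, if_false])]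
          rw [Finset.sum_ite_mem, Finset.inter_self, Finset.sum_const, nsmul_eq_mul]
      _ ≤ _ := by
          gcongr
          exact h.card_le y
  · rw [mul_zero, nonpos_iff_eq_zero, ENNReal.tsum_eq_zero]
    intro x
    rw [if_neg]
    exact fun hx => hy ⟨x, hx⟩

/-- If the boundaries of several colourings cover every vertex with small frequency, then the
restriction of an approximate eigenfunction to some class of some colouring is again an
approximate eigenfunction. -/
theorem exists_energy_classPart_le {ι : Type*} (h : DegreeBound G d) {z : ℂ} {T : ℕ} (hT : 0 < T)
    (c : Fin T → V → ι) {ε δ C : ℝ≥0∞}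
    (hc : ∀ y, (({t | ∃ x, G.Adj x y ∧ c t x ≠ c t y} : Set (Fin T)).ncard : ℝ≥0∞) ≤ ε * T)
    (hC : 2 * δ + 4 * d ^ 2 * ε < C) {f : V → ℂ} (hf0 : energy f ≠ 0) (hf : energy f ≠ ∞)
    (hfδ : energy (shiftedLaplacian G z f) ≤ δ * energy f) :
    ∃ t a, energy (classPart (c t) f a) ≠ 0 ∧
      energy (shiftedLaplacian G z (classPart (c t) f a)) ≤ C * energy (classPart (c t) f a) := by
  classical
  by_contra! hcon
  have hle : ∀ t a, C * energy (classPart (c t) f a) ≤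
      energy (shiftedLaplacian G z (classPart (c t) f a)) := fun t a => by
    by_cases h0 : energy (classPart (c t) f a) = 0
    · simp [h0]
    · exact (hcon t a h0).le
  have hT0 : (T : ℝ≥0∞) ≠ 0 := by exact_mod_cast hT.ne'
  have hTf0 : T * energy f ≠ 0 := mul_ne_zero hT0 hf0
  have hTf : T * energy f ≠ ∞ := ENNReal.mul_ne_top (ENNReal.natCast_ne_top T) hf
  -- If every piece failed, summing over all classes and colourings would give `C ≤ 2 * δ + 4 * d ^
  -- 2 * ε` after division by `T * energy f`.
  refine hC.not_ge ((ENNReal.mul_le_mul_iff_left hTf0 hTf).1 ?_)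
  calc C * (T * energy f) = ∑ t : Fin T, ∑' a, C * energy (classPart (c t) f a) := by
        simp only [ENNReal.tsum_mul_left, tsum_energy_classPart, Finset.sum_const,
          Finset.card_univ, Fintype.card_fin, nsmul_eq_mul]
        ring
    _ ≤ ∑ t : Fin T, (2 * energy (shiftedLaplacian G z f) +
          4 * d ^ 2 * ∑' y, if ∃ x, G.Adj x y ∧ c t x ≠ c t y then ‖f y‖ₑ ^ 2 else 0) := by
        gcongr with t
        exact (ENNReal.tsum_le_tsum fun a => hle t a).trans
          (tsum_energy_shiftedLaplacian_classPart_le h z (c t) f)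
    _ = T * (2 * energy (shiftedLaplacian G z f)) + 4 * d ^ 2 * ∑' y,
          (({t | ∃ x, G.Adj x y ∧ c t x ≠ c t y} : Set (Fin T)).ncard : ℝ≥0∞) * ‖f y‖ₑ ^ 2 := by
        rw [Finset.sum_add_distrib, ← Finset.mul_sum _ _ (4 * (d : ℝ≥0∞) ^ 2),
          ← Summable.tsum_finsetSum fun _ _ => ENNReal.summable]
        simp only [Finset.sum_const, Finset.card_univ, Fintype.card_fin, nsmul_eq_mul]
        congr 3
        ext y
        rw [← Finset.sum_filter, Finset.sum_const, nsmul_eq_mul, Set.ncard_eq_toFinset_card',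
          Set.toFinset_ofPred]
    _ ≤ T * (2 * (δ * energy f)) + 4 * d ^ 2 * ∑' y, ε * T * ‖f y‖ₑ ^ 2 := by
        gcongr with y
        exact hc y
    _ = (2 * δ + 4 * d ^ 2 * ε) * (T * energy f) := by
        rw [ENNReal.tsum_mul_left, ← energy]
        ring

theorem energy_classPart_le {ι : Type*} (c : V → ι) (f : V → ℂ) (a : ι) :
    energy (classPart c f a) ≤ energy f := by
  refine ENNReal.tsum_le_tsum fun x => ?_
  rw [classPart]
  split_ifs <;> simp

/-- There is an approximate eigenfunction for `z`, with error `δ`, supported in the ball of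
radius `r` around `x`. -/
def HasLocalEigenfunction {V : Type*} (G : SimpleGraph V) (z : ℂ) (δ : ℝ) (r : ℕ) (x : V) : Prop :=
  ∃ g : V → ℂ, (∀ y, g y ≠ 0 → y ∈ ballSet G x r) ∧ energy g ≠ 0 ∧ energy g ≠ ∞ ∧
    energy (shiftedLaplacian G z g) ≤ ENNReal.ofReal (δ ^ 2) * energy g

theorem exists_ne_zero_of_energy_ne_zero {f : V → ℂ} (hf : energy f ≠ 0) : ∃ x, f x ≠ 0 := by
  by_contra! hcon
  exact hf (by simp [energy, hcon])

/-- In a strongly almost finite family, spectral values are detected in balls of bounded radius. -/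
theorem StronglyAlmostFinite.exists_hasLocalEigenfunction {ι : Type*} {V : ι → Type*}
    {G : ∀ i, SimpleGraph (V i)} (hG : ∀ i, DegreeBound (G i) d) (hsaf : StronglyAlmostFinite G)
    {δ : ℝ} (hδ : 0 < δ) :
    ∃ r : ℕ, ∀ i, ∀ z ∈ spectrum ℂ (laplacian (G i) d (hG i)),
      ∃ x, HasLocalEigenfunction (G i) z δ r x := by
  -- With this `ε` the boundary term is at most `δ ^ 2 / 2`; the initial error `δ / 3` adds `2 * δ ^
  -- 2 / 9`, for a total below `δ ^ 2`. The radius is `K`, since a class lies in the `K`-ball around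
  -- any of its points.
  obtain ⟨T, K, hT, -, hP⟩ := hsaf (δ ^ 2 / (8 * (d ^ 2 + 1))) (by positivity)
  refine ⟨K, fun i z hz => ?_⟩
  obtain ⟨P, hPart, hPb⟩ := hP i
  obtain ⟨f, -, hf0, hf, hfz⟩ := exists_finite_support_of_mem_spectrum (hG i) hz
    (show 0 < δ / 3 by positivity)
  choose c hcP hcu using fun t x => (hPart t).1.2 x
  have hbd : ∀ y, (({t | ∃ x, (G i).Adj x y ∧ c t x ≠ c t y} : Set (Fin T)).ncard : ℝ≥0∞) ≤
      ENNReal.ofReal (δ ^ 2 / (8 * (d ^ 2 + 1))) * T := by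
    intro y
    have h1 : ({t | ∃ x, (G i).Adj x y ∧ c t x ≠ c t y} : Set (Fin T)) ⊆
        {t | ∃ H ∈ P t, y ∈ vertexBoundary (G i) H} := by
      rintro t ⟨x, hxy, hne⟩
      refine ⟨c t y, (hcP t y).1, (hcP t y).2, x, fun hx => hne ?_, hxy.symm⟩
      exact (hcu t x (c t y) ⟨(hcP t y).1, hx⟩).symm
    have h2 := Set.ncard_le_ncard h1 (Set.toFinite _)
    have h3 := hPb y
    rw [div_lt_iff₀ (by exact_mod_cast hT)] at h3
    rw [← ENNReal.ofReal_natCast, ← ENNReal.ofReal_natCast T,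
      ← ENNReal.ofReal_mul (by positivity)]
    exact ENNReal.ofReal_le_ofReal ((Nat.cast_le.2 h2).trans h3.le)
  have hC : 2 * ENNReal.ofReal ((δ / 3) ^ 2) +
      4 * d ^ 2 * ENNReal.ofReal (δ ^ 2 / (8 * (d ^ 2 + 1))) < ENNReal.ofReal (δ ^ 2) := by
    have h4 : (4 : ℝ≥0∞) * d ^ 2 = ENNReal.ofReal (4 * d ^ 2) := by
      rw [ENNReal.ofReal_mul (by norm_num), ENNReal.ofReal_pow (by positivity)]
      simp
    have h2 : (2 : ℝ≥0∞) = ENNReal.ofReal 2 := by simp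
    rw [h4, h2, ← ENNReal.ofReal_mul (by positivity), ← ENNReal.ofReal_mul (by positivity),
      ← ENNReal.ofReal_add (by positivity) (by positivity),
      ENNReal.ofReal_lt_ofReal_iff (by positivity)]
    have h5 : 4 * (d : ℝ) ^ 2 * (δ ^ 2 / (8 * (d ^ 2 + 1))) ≤ δ ^ 2 / 2 := by
      rw [mul_div_assoc', div_le_div_iff₀ (by positivity) (by positivity)]
      nlinarith [sq_nonneg δ, sq_nonneg (d : ℝ)]
    nlinarith [pow_pos hδ 2]
  obtain ⟨t, a, h0, hle⟩ := exists_energy_classPart_le (hG i) hT c hbd hC hf0 hf hfz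
  obtain ⟨x, hx⟩ := exists_ne_zero_of_energy_ne_zero h0
  have hmem : ∀ {y}, classPart (c t) f a y ≠ 0 → c t y = a := fun {y} hy => by
    by_contra hne
    exact hy (by simp [classPart, hne])
  refine ⟨x, classPart (c t) f a, fun y hy => ?_, h0,
    ((energy_classPart_le _ _ _).trans_lt hf.lt_top).ne, hle⟩
  have hxa := hcP t x
  have hya := hcP t y
  rw [hmem hx] at hxa
  rw [hmem hy] at hya
  exact ((hPart t).2 a hxa.1).2.1 x hxa.2 y hya.2

/-- Spectral values are detected in balls. -/
theorem exists_hasLocalEigenfunction_of_mem_spectrum (h : DegreeBound G d) {z : ℂ}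
    (hz : z ∈ spectrum ℂ (laplacian G d h)) {δ : ℝ} (hδ : 0 < δ) :
    ∃ r x, HasLocalEigenfunction G z δ r x := by
  obtain ⟨f, hfin, hf0, hf, hfz⟩ := exists_finite_support_of_mem_spectrum h hz
    (show 0 < δ / 2 by positivity)
  have hC : 2 * ENNReal.ofReal ((δ / 2) ^ 2) + 4 * d ^ 2 * 0 < ENNReal.ofReal (δ ^ 2) := by
    have h2 : (2 : ℝ≥0∞) = ENNReal.ofReal 2 := by simp
    rw [mul_zero, add_zero, h2, ← ENNReal.ofReal_mul (by positivity),
      ENNReal.ofReal_lt_ofReal_iff (by positivity)]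
    nlinarith [pow_pos hδ 2]
  -- A finite support may meet several components and so lie in no ball. Colouring by components
  -- cuts no edge and isolates a good piece in one component.
  have hbd : ∀ y, (({t | ∃ x, G.Adj x y ∧ G.connectedComponentMk x ≠ G.connectedComponentMk y} :
      Set (Fin 1)).ncard : ℝ≥0∞) ≤ 0 * (1 : ℕ) := fun y => by
    rw [zero_mul, nonpos_iff_eq_zero, Nat.cast_eq_zero, Set.ncard_eq_zero (Set.toFinite _)]
    rw [Set.eq_empty_iff_forall_notMem]
    rintro t ⟨x, hxy, hne⟩
    exact hne (SimpleGraph.ConnectedComponent.sound hxy.reachable)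
  obtain ⟨t, a, h0, hle⟩ := exists_energy_classPart_le h one_pos
    (fun _ : Fin 1 => G.connectedComponentMk) hbd hC hf0 hf hfz
  obtain ⟨x, hx⟩ := exists_ne_zero_of_energy_ne_zero h0
  have hmem : ∀ {y}, classPart G.connectedComponentMk f a y ≠ 0 →
      G.connectedComponentMk y = a ∧ f y ≠ 0 := fun {y} hy => by
    rw [classPart] at hy
    split_ifs at hy with hya
    · exact ⟨hya, hy⟩
    · exact absurd rfl hy
  -- Support points in other components contribute the default distance 0 here, which is harmless:
  -- the piece lives in the component of `x`.
  refine ⟨hfin.toFinset.sup (G.dist x), x, classPart G.connectedComponentMk f a, fun y hy => ?_,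
    h0, ((energy_classPart_le _ _ _).trans_lt hf.lt_top).ne, hle⟩
  have hreach : G.Reachable x y :=
    SimpleGraph.ConnectedComponent.exact ((hmem hx).1.trans (hmem hy).1.symm)
  change G.edist x y ≤ _
  rw [← hreach.coe_dist_eq_edist]
  exact_mod_cast Finset.le_sup (f := G.dist x) (by simpa using (hmem hy).2)

end Localization

/-! ### Transplanting local eigenfunctions between graphs with isomorphic balls. -/

section Transfer

variable {V W : Type*} {G : SimpleGraph V} {H : SimpleGraph W} {d : ℕ}

theorem self_mem_ballSet (G : SimpleGraph V) (x : V) (r : ℕ) : x ∈ ballSet G x r := by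
  simp [ballSet]

theorem ballSet_mono (G : SimpleGraph V) (x : V) {r s : ℕ} (h : r ≤ s) :
    ballSet G x r ⊆ ballSet G x s := fun y hy => by
  change G.edist x y ≤ s
  exact le_trans hy (by exact_mod_cast h)

theorem mem_ballSet_succ_of_adj {x y y' : V} {r : ℕ} (hy : y ∈ ballSet G x r) (h : G.Adj y y') :
    y' ∈ ballSet G x (r + 1) := by
  refine G.edist_triangle.trans (?_ : G.edist x y + G.edist y y' ≤ _)
  rw [SimpleGraph.edist_eq_one_iff_adj.2 h]
  push_cast
  exact add_le_add hy le_rfl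

theorem mem_ballSet_zero {x y : V} : y ∈ ballSet G x 0 ↔ x = y := by
  simp only [ballSet, Set.mem_ofPred_eq, Nat.cast_zero, nonpos_iff_eq_zero]
  exact SimpleGraph.edist_eq_zero_iff

theorem mem_ballSet_succ {x y : V} {r : ℕ} (hy : y ∈ ballSet G x (r + 1)) :
    y ∈ ballSet G x r ∨ ∃ y' ∈ ballSet G x r, G.Adj y' y := by
  have hne : G.edist y x ≠ ⊤ := by
    rw [SimpleGraph.edist_comm]
    exact (lt_of_le_of_lt hy (ENat.natCast_lt_top _)).ne
  -- The walk starts at `y`, so removing its first edge leaves a neighbour of `y` closer to `x`.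
  obtain ⟨p, hp⟩ := SimpleGraph.exists_walk_of_edist_ne_top hne
  have hlen : p.length ≤ r + 1 := by
    have h : G.edist y x ≤ ((r + 1 : ℕ) : ℕ∞) := by rw [SimpleGraph.edist_comm]; exact hy
    rw [← hp] at h
    exact_mod_cast h
  cases p with
  | nil => exact Or.inl (self_mem_ballSet G _ _)
  | cons hadj q =>
    refine Or.inr ⟨_, ?_, hadj.symm⟩
    change G.edist x _ ≤ _
    rw [SimpleGraph.edist_comm]
    refine (SimpleGraph.edist_le q).trans ?_
    rw [SimpleGraph.Walk.length_cons] at hlen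
    exact_mod_cast Nat.le_of_succ_le_succ hlen

/-- A root-preserving isomorphism of balls maps smaller concentric balls into each other. -/
theorem coe_mem_ballSet_of_iso {x : V} {x' : W} {R : ℕ}
    (φ : G.induce (ballSet G x R) ≃g H.induce (ballSet H x' R))
    (hφ : (φ ⟨x, self_mem_ballSet G x R⟩ : W) = x') {k : ℕ} (hk : k ≤ R)
    (y : ballSet G x R) (hy : (y : V) ∈ ballSet G x k) : (φ y : W) ∈ ballSet H x' k := by
  induction k generalizing y with
  | zero =>
    rw [mem_ballSet_zero] at hy
    have : y = ⟨x, self_mem_ballSet G x R⟩ := Subtype.ext hy.symm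
    rw [this, hφ]
    exact self_mem_ballSet H x' 0
  | succ k ih =>
    rcases mem_ballSet_succ hy with hy | ⟨y', hy', hadj⟩
    · exact ballSet_mono H x' k.le_succ (ih (by omega) y hy)
    · have hmem := ballSet_mono G x (show k ≤ R by omega) hy'
      have hadj' : (G.induce (ballSet G x R)).Adj ⟨y', hmem⟩ y := hadj
      exact mem_ballSet_succ_of_adj (ih (by omega) ⟨y', hmem⟩ hy') (φ.map_adj_iff.2 hadj')

/-- The Laplacian of a function supported well inside a set only depends on the induced graph. -/
theorem shiftedLaplacian_eq_induce (z : ℂ) {S : Set V} {g : V → ℂ}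
    (hg : ∀ y, g y ≠ 0 → y ∈ S ∧ ∀ y', G.Adj y y' → y' ∈ S) (x : S) :
    shiftedLaplacian G z g x = shiftedLaplacian (G.induce S) z (fun y => g y) x := by
  have himg : (Subtype.val '' (G.induce S).neighborSet x) = G.neighborSet x ∩ S := by
    ext y
    simp [and_comm]
  have hsum : ∑ᶠ y ∈ (G.induce S).neighborSet x, g y = ∑ᶠ y ∈ G.neighborSet x, g y := by
    rw [← finsum_mem_image (f := g) (g := Subtype.val) Subtype.val_injective.injOn, himg]
    refine finsum_mem_inter_support_eq' _ _ _ fun y hy => ?_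
    simp [(hg y hy).1]
  -- Degrees in the induced graph may drop near the edge of `S`, but only where `g` vanishes.
  have hdeg : ((G.neighborSet x).ncard : ℂ) * g x =
      (((G.induce S).neighborSet x).ncard : ℂ) * g x := by
    by_cases hx : g x = 0
    · simp [hx]
    · congr 2
      rw [← Set.ncard_image_of_injective _ Subtype.val_injective, himg,
        Set.inter_eq_self_of_subset_left (s := G.neighborSet x) fun y hy => (hg x hx).2 y hy]
  rw [shiftedLaplacian, shiftedLaplacian, laplacianFun, laplacianFun, hsum, hdeg]

theorem energy_eq_restrict {S : Set V} {g : V → ℂ} (hg : ∀ y, g y ≠ 0 → y ∈ S) :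
    energy g = energy fun y : S => g y := by
  unfold energy
  refine (tsum_subtype_eq_of_support_subset (f := fun y => ‖g y‖ₑ ^ 2) fun y hy => ?_).symm
  refine hg y fun h0 => hy ?_
  simp [h0]

theorem shiftedLaplacian_eq_zero (h : DegreeBound G d) (z : ℂ) {g : V → ℂ} {x : V}
    (hx : g x = 0) (hy : ∀ y, G.Adj x y → g y = 0) : shiftedLaplacian G z g x = 0 := by
  rw [shiftedLaplacian, laplacianFun_eq_sum h, hx, mul_zero, sub_zero]
  exact Finset.sum_eq_zero fun y hy' => by rw [hy y (by simpa using hy'), sub_zero]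

theorem energy_shiftedLaplacian_eq_induce (h : DegreeBound G d) (z : ℂ) {S : Set V} {g : V → ℂ}
    (hg : ∀ y, g y ≠ 0 → y ∈ S ∧ ∀ y', G.Adj y y' → y' ∈ S) :
    energy (shiftedLaplacian G z g) =
      energy (shiftedLaplacian (G.induce S) z fun y : S => g y) := by
  rw [energy_eq_restrict (S := S) fun y hy => ?_]
  · congr 1
    ext x
    exact shiftedLaplacian_eq_induce z hg x
  · by_contra hyS
    refine hy (shiftedLaplacian_eq_zero h z ?_ fun y' hadj => ?_)
    · by_contra h0
      exact hyS (hg y h0).1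
    · by_contra h0
      exact hyS ((hg y' h0).2 y hadj.symm)

theorem energy_comp_equiv (e : V ≃ W) (g : W → ℂ) : energy (fun x => g (e x)) = energy g :=
  e.tsum_eq fun y => ‖g y‖ₑ ^ 2

theorem shiftedLaplacian_comp_iso (φ : G ≃g H) (z : ℂ) (g : W → ℂ) (x : V) :
    shiftedLaplacian G z (fun y => g (φ y)) x = shiftedLaplacian H z g (φ x) := by
  have himg : φ '' G.neighborSet x = H.neighborSet (φ x) := by
    ext y
    obtain ⟨y, rfl⟩ := φ.surjective y
    simp [φ.map_adj_iff]
  rw [shiftedLaplacian, shiftedLaplacian, laplacianFun, laplacianFun, ← himg,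
    finsum_mem_image φ.injective.injOn, Set.ncard_image_of_injective _ φ.injective]

open Classical in
-- The extra layer in radius `r + 1` contains every neighbour of the support, so both the degrees on
-- the support and the values of the Laplacian around it are visible in the ball.
theorem HasLocalEigenfunction.of_iso (h : DegreeBound G d) (h' : DegreeBound H d) {z : ℂ} {δ : ℝ}
    {r : ℕ} {x : V} {x' : W} (hloc : HasLocalEigenfunction G z δ r x)
    (φ : G.induce (ballSet G x (r + 1)) ≃g H.induce (ballSet H x' (r + 1)))
    (hφ : (φ ⟨x, self_mem_ballSet G x (r + 1)⟩ : W) = x') :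
    HasLocalEigenfunction H z δ r x' := by
  obtain ⟨g, hgs, hg0, hg, hgz⟩ := hloc
  have hgS : ∀ y, g y ≠ 0 → y ∈ ballSet G x (r + 1) ∧
      ∀ y', G.Adj y y' → y' ∈ ballSet G x (r + 1) := fun y hy =>
    ⟨ballSet_mono G x r.le_succ (hgs y hy), fun y' => mem_ballSet_succ_of_adj (hgs y hy)⟩
  set g' : W → ℂ := fun w =>
    if hw : w ∈ ballSet H x' (r + 1) then g (φ.symm ⟨w, hw⟩) else 0 with hg'
  have hg's : ∀ w, g' w ≠ 0 → w ∈ ballSet H x' r := fun w hw => by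
    by_cases hwS : w ∈ ballSet H x' (r + 1)
    · simp only [hg', dif_pos hwS] at hw
      simpa using coe_mem_ballSet_of_iso φ hφ r.le_succ _ (hgs _ hw)
    · simp [hg', hwS] at hw
  have hg'S : ∀ y, g' y ≠ 0 → y ∈ ballSet H x' (r + 1) ∧
      ∀ y', H.Adj y y' → y' ∈ ballSet H x' (r + 1) := fun y hy =>
    ⟨ballSet_mono H x' r.le_succ (hg's y hy), fun y' => mem_ballSet_succ_of_adj (hg's y hy)⟩
  have hcomp : ∀ y : ballSet G x (r + 1), g' (φ y) = g y := fun y => by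
    rw [hg']
    simp
  have he : energy g' = energy g := by
    rw [energy_eq_restrict fun y hy => (hgS y hy).1, energy_eq_restrict fun y hy => (hg'S y hy).1,
      ← energy_comp_equiv φ.toEquiv]
    exact congrArg energy (funext hcomp)
  have hez : energy (shiftedLaplacian H z g') = energy (shiftedLaplacian G z g) := by
    rw [energy_shiftedLaplacian_eq_induce h z hgS, energy_shiftedLaplacian_eq_induce h' z hg'S,
      ← energy_comp_equiv φ.toEquiv]
    refine congrArg energy (funext fun y => ?_)
    have := shiftedLaplacian_comp_iso φ z (fun w => g' w) y
    simp only [hcomp] at this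
    exact this.symm
  refine ⟨g', hg's, ?_, ?_, ?_⟩
  · rwa [he]
  · rwa [he]
  · rwa [he, hez]

theorem HasLocalEigenfunction.exists_of_mem_rootedBalls (h : DegreeBound G d)
    (h' : DegreeBound H d) {z : ℂ} {δ : ℝ} {r : ℕ} {x : V} (hloc : HasLocalEigenfunction G z δ r x)
    {B : FiniteRootedGraph} (φ : B.graph ≃g G.induce (ballSet G x (r + 1)))
    (hφ : (φ B.root : V) = x) (hB : B ∈ rootedBalls H (r + 1)) :
    ∃ x', HasLocalEigenfunction H z δ r x' := by
  obtain ⟨x', ψ, hψ⟩ := hB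
  refine ⟨x', hloc.of_iso h h' (φ.symm.trans ψ) ?_⟩
  have : (⟨x, self_mem_ballSet G x (r + 1)⟩ : ballSet G x (r + 1)) = φ B.root :=
    Subtype.ext hφ.symm
  rw [this]
  simpa using hψ

theorem HasLocalEigenfunction.exists_mem_spectrum (h : DegreeBound G d) {z : ℂ}
    (hre : (z.re : ℂ) = z) {δ : ℝ} (hδ : 0 ≤ δ) {r : ℕ} {x : V}
    (hloc : HasLocalEigenfunction G z δ r x) :
    ∃ w ∈ spectrum ℂ (laplacian G d h), dist w z ≤ δ := by
  obtain ⟨g, -, hg0, hg, hgz⟩ := hloc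
  exact exists_mem_spectrum_of_energy_le h hre hδ hg0 hg hgz

end Transfer

/-! ### Finiteness of the set of ball types. -/

section Balls

variable {V : Type*} {G : SimpleGraph V} {d : ℕ}

theorem encard_ballSet_le (h : DegreeBound G d) (x : V) (r : ℕ) :
    (ballSet G x r).encard ≤ ((d + 1) ^ r : ℕ) := by
  induction r with
  | zero =>
    have : ballSet G x 0 = {x} := by
      ext y
      rw [mem_ballSet_zero, Set.mem_singleton_iff, eq_comm]
    simp [this]
  | succ r ih =>
    classical
    have hfin : (ballSet G x r).Finite := Set.finite_of_encard_le_coe ih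
    have hsub : ballSet G x (r + 1) ⊆
        (hfin.toFinset.biUnion fun y => insert y (h.finite y).toFinset : Finset V) := by
      intro y hy
      simp only [Finset.coe_biUnion, Set.mem_iUnion, Set.Finite.coe_toFinset]
      rcases mem_ballSet_succ hy with hy | ⟨y', hy', hadj⟩
      · exact ⟨y, hy, by simp⟩
      · exact ⟨y', hy', by simp [hadj]⟩
    refine (Set.encard_le_encard hsub).trans ?_
    rw [Set.encard_coe_eq_coe_finsetCard]
    norm_cast
    rw [pow_succ]
    refine (Finset.card_biUnion_le_card_mul _ _ (d + 1) fun y _ =>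
      (Finset.card_insert_le _ _).trans (Nat.succ_le_succ (h.card_le y))).trans ?_
    refine Nat.mul_le_mul_right _ ?_
    rw [hfin.encard_eq_coe_toFinset_card] at ih
    exact_mod_cast ih

theorem exists_iso_ballSet (h : DegreeBound G d) (x : V) (r : ℕ) :
    ∃ (B : FiniteRootedGraph) (φ : B.graph ≃g G.induce (ballSet G x r)),
      B.card ≤ (d + 1) ^ r ∧ (φ B.root : V) = x := by
  have hle := encard_ballSet_le h x r
  have hfin : (ballSet G x r).Finite := Set.finite_of_encard_le_coe hle
  have := hfin.fintype
  let e : Fin (Fintype.card (ballSet G x r)) ≃ ballSet G x r := (Fintype.equivFin _).symm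
  refine ⟨⟨_, (G.induce (ballSet G x r)).comap e, e.symm ⟨x, self_mem_ballSet G x r⟩⟩,
    SimpleGraph.Iso.comap e _, ?_, ?_⟩
  · rw [Set.encard_eq_coe_toFinset_card, Set.toFinset_card] at hle
    exact_mod_cast hle
  · exact congrArg Subtype.val (e.apply_symm_apply _)

theorem finite_setOf_card_le (M : ℕ) : {B : FiniteRootedGraph | B.card ≤ M}.Finite := by
  have : {B : FiniteRootedGraph | B.card ≤ M} ⊆
      Set.range fun p : Σ n : Fin (M + 1), SimpleGraph (Fin n) × Fin n =>
        (⟨p.1, p.2.1, p.2.2⟩ : FiniteRootedGraph) := fun B hB =>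
    ⟨⟨⟨B.card, Nat.lt_succ_of_le hB⟩, B.graph, B.root⟩, rfl⟩
  exact (Set.finite_range _).subset this

end Balls

/-! ### Comparison of spectra along a naively convergent sequence. -/

/-- The dichotomy in naive convergence is essential: a ball absent from the limit is then absent
from almost all `G n`, not merely from infinitely many. -/
theorem NaiveLimit.eventually_mem_iff {V : ℕ → Type*} {G : ∀ n, SimpleGraph (V n)} {W : Type*}
    {H : SimpleGraph W} (hlim : NaiveLimit G H) {r : ℕ} (hr : 0 < r) (B : FiniteRootedGraph) :
    ∀ᶠ n in Filter.atTop, B ∈ rootedBalls (G n) r ↔ B ∈ rootedBalls H r := by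
  have hB := hlim.2 r hr B
  rcases hlim.1 r hr B with hN | hN
  · obtain ⟨N, hN'⟩ := id hN
    filter_upwards [Filter.eventually_ge_atTop N] with n hn
    exact iff_of_true (hN' n hn) (hB.2 hN)
  · obtain ⟨N, hN⟩ := hN
    filter_upwards [Filter.eventually_ge_atTop N] with n hn
    refine iff_of_false (hN n hn) fun hmem => ?_
    obtain ⟨N', hN'⟩ := hB.1 hmem
    exact hN (max N N') (le_max_left _ _) (hN' _ (le_max_right _ _))

theorem mem_spectrum_laplacian_re {V : Type*} {G : SimpleGraph V} {d : ℕ} (h : DegreeBound G d)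
    {z : ℂ} (hz : z ∈ spectrum ℂ (laplacian G d h)) : (z.re : ℂ) = z :=
  ((isSelfAdjoint_laplacian h).mem_spectrum_eq_re hz).symm

/-- Spectral values of the graphs of the sequence are eventually close to those of the limit. -/
theorem NaiveLimit.eventually_spectrum_subset {d : ℕ} {V : ℕ → Type*} {G : ∀ n, SimpleGraph (V n)}
    (hG : ∀ n, DegreeBound (G n) d) {W : Type*} {H : SimpleGraph W} (hH : DegreeBound H d)
    (hsaf : StronglyAlmostFinite G) (hlim : NaiveLimit G H) {δ : ℝ} (hδ : 0 < δ) :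
    ∀ᶠ n in Filter.atTop, ∀ z ∈ spectrum ℂ (laplacian (G n) d (hG n)),
      ∃ w ∈ spectrum ℂ (laplacian H d hH), dist w z ≤ δ := by
  obtain ⟨r, hr⟩ := hsaf.exists_hasLocalEigenfunction hG hδ
  -- As `r` does not depend on `n`, finitely many ball types have to stabilize, so one threshold
  -- serves all spectral values.
  have hev := (Filter.eventually_all_finite (finite_setOf_card_le ((d + 1) ^ (r + 1)))).2
    fun B _ => hlim.eventually_mem_iff r.succ_pos B
  filter_upwards [hev] with n hn z hz
  obtain ⟨x, hx⟩ := hr n z hz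
  obtain ⟨B, φ, hcard, hφ⟩ := exists_iso_ballSet (hG n) x (r + 1)
  obtain ⟨x', hx'⟩ := hx.exists_of_mem_rootedBalls (hG n) hH φ hφ
    ((hn B hcard).1 ⟨x, φ, hφ⟩)
  exact hx'.exists_mem_spectrum hH (mem_spectrum_laplacian_re (hG n) hz) hδ.le

/-- Spectral values of the limit are eventually close to those of the graphs of the sequence. -/
theorem NaiveLimit.eventually_spectrum_superset {d : ℕ} {V : ℕ → Type*}
    {G : ∀ n, SimpleGraph (V n)} (hG : ∀ n, DegreeBound (G n) d) {W : Type*} {H : SimpleGraph W}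
    (hH : DegreeBound H d) (hlim : NaiveLimit G H) {δ : ℝ} (hδ : 0 < δ) :
    ∀ᶠ n in Filter.atTop, ∀ z ∈ spectrum ℂ (laplacian H d hH),
      ∃ w ∈ spectrum ℂ (laplacian (G n) d (hG n)), dist w z ≤ δ := by
  -- A finite `δ / 2`-net of the limit spectrum: the radius of the witnessing ball may then vary
  -- with the point.
  obtain ⟨t, hts, htfin, htcover⟩ := (spectrum.isCompact (𝕜 := ℂ)
    (laplacian H d hH)).finite_cover_balls (half_pos hδ)
  have hev : ∀ᶠ n in Filter.atTop, ∀ z ∈ t, ∃ w ∈ spectrum ℂ (laplacian (G n) d (hG n)),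
      dist w z ≤ δ / 2 := by
    refine (Filter.eventually_all_finite htfin).2 fun z hz => ?_
    obtain ⟨r, x, hx⟩ := exists_hasLocalEigenfunction_of_mem_spectrum hH (hts hz) (half_pos hδ)
    obtain ⟨B, φ, -, hφ⟩ := exists_iso_ballSet hH x (r + 1)
    filter_upwards [hlim.eventually_mem_iff r.succ_pos B] with n hn
    obtain ⟨x', hx'⟩ := hx.exists_of_mem_rootedBalls hH (hG n) φ hφ (hn.2 ⟨x, φ, hφ⟩)
    exact hx'.exists_mem_spectrum (hG n) (mem_spectrum_laplacian_re hH (hts hz)) (half_pos hδ).le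
  filter_upwards [hev] with n hn z hz
  obtain ⟨z', hz', hzz'⟩ := Set.mem_iUnion₂.1 (htcover hz)
  obtain ⟨w, hw, hwz'⟩ := hn z' hz'
  refine ⟨w, hw, (dist_triangle w z' z).trans ?_⟩
  rw [Metric.mem_ball, dist_comm] at hzz'
  linarith

end GraphLimit

theorem mainTheorem6 (d : ℕ)
    (V : ℕ → Type*) [∀ n, Countable (V n)] (G : ∀ n, SimpleGraph (V n))
    (hG : ∀ n, GraphLimit.DegreeBound (G n) d)
    (W : Type*) [Countable W] (H : SimpleGraph W) (hH : GraphLimit.DegreeBound H d)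
    (hsaf : GraphLimit.StronglyAlmostFinite G) (hlim : GraphLimit.NaiveLimit G H) :
    Filter.Tendsto
      (fun n => Metric.hausdorffEDist
        (spectrum ℂ (GraphLimit.laplacian (G n) d (hG n)))
        (spectrum ℂ (GraphLimit.laplacian H d hH)))
      Filter.atTop (nhds 0) := by
  rw [ENNReal.tendsto_nhds_zero]
  intro ε hε
  obtain ⟨δ, hδ, hδε⟩ : ∃ δ : ℝ, 0 < δ ∧ ENNReal.ofReal δ ≤ ε := by
    obtain ⟨δ, hδ, hδε⟩ := ENNReal.lt_iff_exists_nnreal_btwn.1 hε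
    exact ⟨δ, by exact_mod_cast hδ, by rw [ENNReal.ofReal_coe_nnreal]; exact hδε.le⟩
  filter_upwards [hlim.eventually_spectrum_subset hG hH hsaf hδ,
    hlim.eventually_spectrum_superset hG hH hδ] with n h1 h2
  refine (Metric.hausdorffEDist_le_of_mem_edist (r := ENNReal.ofReal δ) (fun z hz => ?_)
    fun z hz => ?_).trans hδε
  · obtain ⟨w, hw, hwz⟩ := h1 z hz
    exact ⟨w, hw, by rw [edist_comm, edist_dist]; exact ENNReal.ofReal_le_ofReal hwz⟩
  · obtain ⟨w, hw, hwz⟩ := h2 z hz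
    exact ⟨w, hw, by rw [edist_comm, edist_dist]; exact ENNReal.ofReal_le_ofReal hwz⟩
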